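/- Let $Z$ be a standard one-dimensional Brownian motion on a probability space $(\Omega,\mathcal F,\mathsf P)$, let $T\ge 0$, $\mathcal Z_t=\sigma(Z_s:s\le t)$, and let $L^2_{\mathcal Z_t}(\mathbb R^d)$ be the space of (classes of) square-integrable $\mathcal Z_t$-measurable random vectors. The set of admissible controls is $\mathcal U=L^2_{\mathcal Z}([0,T];\mathbb R)$, the progressively measurable processes $U$ with $\mathsf E\int_0^T|U_t|^2\,dt<\infty$. Let $\xi\in L^2_{\mathcal Z_T}(\mathbb R^d)$; let $f:\mathbb R^d\times\mathbb R^d\times\mathbb R\times[0,T]\times\Omega\to\mathbb R^d$ be Lipschitz in $(y,v,u)$ with a uniform constant, almost surely and for almost every $t$, with $f(y,v,u,\cdot)$ measurable and $\mathcal Z$-adapted for all $y,v,u$; let $h:\mathbb R^d\to\mathbb R$ be bounded and measurable; and let $l:\mathbb R^d\times\mathbb R^d\times\mathbb R\times[0,T]\times\Omega\to\mathbb R$ be measurable and almost surely bounded (by a constant), with $l(y,v,u,\cdot)$ $\mathcal Z$-adapted for all $y,v,u$. For $U\in\mathcal U$, let $(Y,V)$ denote a solution pair of the BSDE $$dY_t=f(Y_t,V_t,U_t,t)\,dt+V_t\,dZ_t,\qquad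 Y_T=\xi,$$ with $Y,V\in L^2_{\mathcal Z}([0,T];\mathbb R^d)$ and $Y_t\in L^2_{\mathcal Z_t}(\mathbb R^d)$ for every $t$, and let $$\mathsf J_T(U;\xi)=\mathsf E\Big(h(Y_0)+\int_0^T l(Y_t,V_t,U_t,t)\,dt\Big)$$ be its cost. Suppose that there are a family $\mathcal V=\{\mathcal V_t:0\le t\le T\}$ of maps, where $\mathcal V_t$ assigns to each $\zeta\in L^2_{\mathcal Z_t}(\mathbb R^d)$ a real random variable $\mathcal V_t(\zeta)$ (possibly a constant), and a control $U^*\in\mathcal U$ with a solution pair $(Y^*,V^*)$ of the BSDE, such that: (i) $\mathcal V_0(\zeta)=h(\zeta)$ almost surely for every $\zeta\in L^2_{\mathcal Z_0}(\mathbb R^d)$; (ii) the process $$M^U_t=\mathcal V_t(Y_t)-\int_0^t l(Y_\tau,V_\tau,U_\tau,\tau)\,d\tau,\qquad 0\le t\le T,$$ is a $\mathcal Z$-supermartingale for every $U\in\mathcal U$ and every solution pair $(Y,V)$ of the BSDE for $U$, and $M^{U^*}$, formed with $(Y^*,V^*)$, is a $\mathcal Z$-martingale. Then $U^*$ is an optimal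 control: the cost of $U^*$ with $(Y^*,V^*)$ is at most the cost of each $U\in\mathcal U$ with each solution pair of its BSDE. Moreover $\mathcal V_T(\xi)$ is integrable and the optimal cost is $\mathsf J_T(U^*;\xi)=\mathsf E\big(\mathcal V_T(\xi)\big)$. -/

import Mathlib

open MeasureTheory ProbabilityTheory Filter Topology
open scoped NNReal ENNReal

noncomputable section

namespace BSDEControl

/-- The time interval `[0, T]`. -/
abbrev Horizon (T : ℝ≥0) : Type := Set.Icc (0 : ℝ) (T : ℝ)

/-- Lebesgue measure on `[0, T]`. -/
def lebesgue (T : ℝ≥0) : Measure (Horizon T) := Measure.comap Subtype.val volume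

/-- The initial time `0` of `[0, T]`. -/
def Horizon.initial (T : ℝ≥0) : Horizon T := ⟨0, le_refl _, T.2⟩

/-- The terminal time `T` of `[0, T]`. -/
def Horizon.final (T : ℝ≥0) : Horizon T := ⟨T, T.2, le_refl _⟩

/-- The space `ℝ^d`. -/
abbrev State (d : ℕ) : Type := EuclideanSpace ℝ (Fin d)

variable {Ω : Type*} {mΩ : MeasurableSpace Ω} {T : ℝ≥0} {d : ℕ}

/-- The restriction to `[0, T]` of a process indexed by `[0, ∞)`. -/
def restrict (Z : ℝ≥0 → Ω → ℝ) (T : ℝ≥0) : Horizon T → Ω → ℝ :=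
  fun t => Z ⟨(t : ℝ), t.2.1⟩

/-- The filtration `𝒵_t = σ(Z_s : s ≤ t)`, `t ∈ [0, T]`, generated by the process `Z`. -/
def obsFiltration (Z : ℝ≥0 → Ω → ℝ) (hZ : ∀ t, Measurable (Z t)) (T : ℝ≥0) :
    Filtration (Horizon T) mΩ :=
  Filtration.natural (restrict Z T) (fun _ => (hZ _).stronglyMeasurable)

/-- Elements of `L²_𝒵([0,T]; E)`: progressively measurable processes `X` with
`𝔼 ∫_0^T ‖X_t‖² dt < ∞`. (Each adapted, jointly measurable process has a progressively measurable
modification.) -/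
structure IsL2Process {E : Type*} [NormedAddCommGroup E] (𝓕 : Filtration (Horizon T) mΩ)
    (P : Measure Ω) (X : Horizon T → Ω → E) : Prop where
  progressive : IsStronglyProgressive 𝓕 X
  memLp : MemLp (fun p : Horizon T × Ω => X p.1 p.2) 2
    ((lebesgue T).prod P)

/-- The space `L²_{𝒵_t}(ℝ^d)` of (classes of) square integrable, `𝒵_t`-measurable random vectors. -/
abbrev L2RV (d : ℕ) (𝓕 : Filtration (Horizon T) mΩ) (P : Measure Ω) (t : Horizon T) : Type _ :=
  lpMeas (State d) ℝ (𝓕 t) 2 P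

/-! ### The Itô integral -/

/-- A simple process `∑_{i<n} η_i 1_{(t_i, t_{i+1}]}` with `t_0 ≤ t_1 ≤ ⋯ ≤ t_n` in `[0, T]` and each
`η_i` bounded and `𝓕_{t_i}`-measurable. -/
structure SimpleProcess (𝓕 : Filtration (Horizon T) mΩ) (E : Type*) [NormedAddCommGroup E] where
  n : ℕ
  time : ℕ → Horizon T
  mono : Monotone time
  val : ℕ → Ω → E
  measurable_val : ∀ i, StronglyMeasurable[𝓕 (time i)] (val i)
  bounded_val : ∀ i, ∃ C : ℝ, ∀ ω, ‖val i ω‖ ≤ C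

/-- The value at time `t` of a simple process. -/
def SimpleProcess.eval {𝓕 : Filtration (Horizon T) mΩ} {E : Type*} [NormedAddCommGroup E]
    (S : SimpleProcess 𝓕 E) (t : Horizon T) (ω : Ω) : E :=
  ∑ i ∈ Finset.range S.n,
    (Set.Ioc (S.time i) (S.time (i + 1))).indicator (fun _ => S.val i ω) t

/-- The integral `∫_0^t S dZ = ∑_i (Z_{t_{i+1} ∧ t} - Z_{t_i ∧ t}) η_i` of a simple process. -/
def SimpleProcess.integral {𝓕 : Filtration (Horizon T) mΩ} {E : Type*} [NormedAddCommGroup E]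
    [NormedSpace ℝ E] (S : SimpleProcess 𝓕 E) (Z : Horizon T → Ω → ℝ) (t : Horizon T) (ω : Ω) : E :=
  ∑ i ∈ Finset.range S.n,
    (Z (min (S.time (i + 1)) t) ω - Z (min (S.time i) t) ω) • S.val i ω

/-- `I_t = ∫_0^t V dZ` for all `t ∈ [0, T]`, in the sense of Itô: for some sequence of simple
processes that converges to `V` in `L²(dt ⊗ P)`, the elementary integrals up to any time `t`
converge to `I_t` in `L²(P)`. -/
def IsItoIntegral {E : Type*} [NormedAddCommGroup E] [NormedSpace ℝ E]
    (𝓕 : Filtration (Horizon T) mΩ) (P : Measure Ω) (Z : Horizon T → Ω → ℝ)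
    (V I : Horizon T → Ω → E) : Prop :=
  ∃ S : ℕ → SimpleProcess 𝓕 E,
    Tendsto (fun k => eLpNorm (fun p : Horizon T × Ω => (S k).eval p.1 p.2 - V p.1 p.2) 2
      ((lebesgue T).prod P)) atTop (𝓝 0) ∧
    ∀ t, MemLp (I t) 2 P ∧
      Tendsto (fun k => eLpNorm (fun ω => (S k).integral Z t ω - I t ω) 2 P) atTop (𝓝 0)

/-! ### The control problem -/

/-- The data of the control problem: drift `f`, running cost `l`, cost `h` of the initial state and
terminal condition `ξ`. -/
structure Data (d : ℕ) (𝓕 : Filtration (Horizon T) mΩ) (P : Measure Ω) where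
  /-- the drift `f(y, v, u, t; ω)` -/
  f : State d → State d → ℝ → Horizon T → Ω → State d
  /-- the running cost `l(y, v, u, t; ω)` -/
  l : State d → State d → ℝ → Horizon T → Ω → ℝ
  /-- the cost of the initial state -/
  h : State d → ℝ
  /-- the terminal condition -/
  ξ : L2RV d 𝓕 P (Horizon.final T)

/-- The standing assumptions on the data. -/
structure Data.Standing {𝓕 : Filtration (Horizon T) mΩ} {P : Measure Ω} (D : Data d 𝓕 P) :
    Prop where
  f_measurable : ∀ y v u, Measurable (fun p : Horizon T × Ω => D.f y v u p.1 p.2)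
  f_adapted : ∀ y v u, StronglyAdapted 𝓕 (D.f y v u)
  f_lipschitz : ∃ K : ℝ, ∀ᵐ ω ∂P, ∀ᵐ t ∂(lebesgue T), ∀ y v u y' v' u',
    ‖D.f y v u t ω - D.f y' v' u' t ω‖ ≤ K * (‖y - y'‖ + ‖v - v'‖ + |u - u'|)
  h_measurable : Measurable D.h
  h_bounded : ∃ C : ℝ, ∀ y, |D.h y| ≤ C
  l_measurable : Measurable
    (fun p : State d × State d × ℝ × Horizon T × Ω => D.l p.1 p.2.1 p.2.2.1 p.2.2.2.1 p.2.2.2.2)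
  l_adapted : ∀ y v u, StronglyAdapted 𝓕 (D.l y v u)
  l_bounded : ∃ C : ℝ, ∀ᵐ ω ∂P, ∀ y v u t, |D.l y v u t ω| ≤ C

/-- A solution pair `(Y, V)` of the BSDE `dY_t = f(Y_t, V_t, U_t, t) dt + V_t dZ_t`, `Y_T = ξ`,
for the control `U`, that is,
`ξ - Y_t = ∫_t^T f(Y_τ, V_τ, U_τ, τ) dτ + ∫_t^T V_τ dZ_τ` almost surely, for each `t ∈ [0, T]`. -/
structure Solution {𝓕 : Filtration (Horizon T) mΩ} {P : Measure Ω} (D : Data d 𝓕 P)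
    (Z : Horizon T → Ω → ℝ) (U : Horizon T → Ω → ℝ) where
  Y : Horizon T → Ω → State d
  V : Horizon T → Ω → State d
  isL2_Y : IsL2Process 𝓕 P Y
  isL2_V : IsL2Process 𝓕 P V
  memLp_Y : ∀ t, MemLp (Y t) 2 P
  integrable_drift : ∀ᵐ ω ∂P,
    Integrable (fun t : Horizon T => D.f (Y t ω) (V t ω) (U t ω) t ω) (lebesgue T)
  equation : ∃ I : Horizon T → Ω → State d, IsItoIntegral 𝓕 P Z V I ∧
    ∀ t, ∀ᵐ ω ∂P, D.ξ.1 ω - Y t ω =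
      (∫ τ in Set.Ioi t, D.f (Y τ ω) (V τ ω) (U τ ω) τ ω ∂(lebesgue T)) + (I (Horizon.final T) ω - I t ω)

namespace Solution

variable {𝓕 : Filtration (Horizon T) mΩ} {P : Measure Ω} {D : Data d 𝓕 P}
  {Z U : Horizon T → Ω → ℝ}

/-- `Y_t` as an element of `L²_{𝒵_t}(ℝ^d)`. -/
def stateAt (S : Solution D Z U) (t : Horizon T) : L2RV d 𝓕 P t :=
  ⟨(S.memLp_Y t).toLp (S.Y t), mem_lpMeas_iff_aestronglyMeasurable.2
    ((S.isL2_Y.progressive.stronglyAdapted t).aestronglyMeasurable.congr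
      (S.memLp_Y t).coeFn_toLp.symm)⟩

/-- The running cost `∫_0^t l(Y_τ, V_τ, U_τ, τ) dτ`. -/
def runningCost (S : Solution D Z U) (t : Horizon T) (ω : Ω) : ℝ :=
  ∫ τ in Set.Iic t, D.l (S.Y τ ω) (S.V τ ω) (U τ ω) τ ω ∂(lebesgue T)

/-- The cost `J_T(U; ξ) = 𝔼 (h(Y_0) + ∫_0^T l(Y_t, V_t, U_t, t) dt)`. -/
def cost (S : Solution D Z U) : ℝ :=
  ∫ ω, (D.h (S.Y (Horizon.initial T) ω) + S.runningCost (Horizon.final T) ω) ∂P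

/-- The process `M^U_t = 𝒱_t(Y_t) - ∫_0^t l(Y_τ, V_τ, U_τ, τ) dτ`. -/
def M (S : Solution D Z U) (𝒱 : (t : Horizon T) → L2RV d 𝓕 P t → Ω → ℝ) :
    Horizon T → Ω → ℝ :=
  fun t ω => 𝒱 t (S.stateAt t) ω - S.runningCost t ω

/-- `U`, with state `(Y, V)`, is an optimal control: it is admissible, and its cost is at most that
of every admissible control. -/
def IsOptimal (S : Solution D Z U) : Prop :=
  IsL2Process 𝓕 P U ∧
    ∀ U' : Horizon T → Ω → ℝ, IsL2Process 𝓕 P U' → ∀ S' : Solution D Z U', S.cost ≤ S'.cost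

end Solution

end BSDEControl

end

namespace BSDEControl

variable {Ω : Type*} {mΩ : MeasurableSpace Ω} {T : ℝ≥0} {d : ℕ}

/-! This is the verification argument by the martingale principle. At time `0` the running cost
vanishes, so `M` has mean `𝔼 h(Y_0)`; at time `T` the state is `ξ` whatever the control, so `M` has
mean `𝔼 𝒱_T(ξ)` minus the expected running cost. A supermartingale has nonincreasing mean, hence `𝔼
𝒱_T(ξ)` bounds every cost from below, and constancy of the mean along `U*` gives equality. Splitting
the expectations rests on `integrable_runningCost`; independence of the control rests on
`stateAt_final`. -/

theorem lebesgue_apply (T : ℝ≥0) (s : Set (Horizon T)) :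
    lebesgue T s = volume (Subtype.val '' s) :=
  (MeasurableEmbedding.subtype_coe measurableSet_Icc).comap_apply _ _

instance isFiniteMeasure_lebesgue (T : ℝ≥0) : IsFiniteMeasure (lebesgue T) where
  measure_univ_lt_top := by
    rw [lebesgue_apply, Set.image_univ, Subtype.range_coe]
    exact measure_Icc_lt_top

theorem lebesgue_singleton (t : Horizon T) : lebesgue T {t} = 0 := by
  rw [lebesgue_apply, Set.image_singleton, Real.volume_singleton]

theorem Iic_initial (T : ℝ≥0) : Set.Iic (Horizon.initial T) = {Horizon.initial T} :=
  Set.eq_singleton_iff_unique_mem.2 ⟨Set.self_mem_Iic, fun t ht => le_antisymm ht t.2.1⟩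

theorem Ioi_final (T : ℝ≥0) : Set.Ioi (Horizon.final T) = ∅ :=
  Set.eq_empty_of_forall_notMem fun t ht => absurd t.2.2 (not_le.2 ht)

namespace Solution

variable {𝓕 : Filtration (Horizon T) mΩ} {P : Measure Ω} {D : Data d 𝓕 P}
  {Z U : Horizon T → Ω → ℝ}

theorem coeFn_stateAt (S : Solution D Z U) (t : Horizon T) :
    (S.stateAt t).1 =ᵐ[P] S.Y t :=
  (S.memLp_Y t).coeFn_toLp

/-- At `t = T` both integrals in the equation drop out, the stochastic one as `I_T - I_T`. Equality
of classes is what is needed: it allows substitution inside the arbitrary map `𝒱_T`. -/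
theorem stateAt_final (S : Solution D Z U) : S.stateAt (Horizon.final T) = D.ξ := by
  obtain ⟨I, -, hI⟩ := S.equation
  refine Subtype.ext (Lp.ext ?_)
  filter_upwards [S.coeFn_stateAt (Horizon.final T), hI (Horizon.final T)] with ω hY hω
  rw [Ioi_final, setIntegral_empty, sub_self, add_zero, sub_eq_zero] at hω
  rw [hY, hω]

theorem runningCost_initial (S : Solution D Z U) (ω : Ω) :
    S.runningCost (Horizon.initial T) ω = 0 := by
  rw [runningCost, Iic_initial]
  exact setIntegral_measure_zero _ (lebesgue_singleton _)

theorem integrable_runningCost [IsFiniteMeasure P] (hD : D.Standing) (hU : IsL2Process 𝓕 P U)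
    (S : Solution D Z U) (t : Horizon T) : Integrable (S.runningCost t) P := by
  obtain ⟨C, hC⟩ := hD.l_bounded
  have hl : AEMeasurable (fun p : Horizon T × Ω =>
      D.l (S.Y p.1 p.2) (S.V p.1 p.2) (U p.1 p.2) p.1 p.2) ((lebesgue T).prod P) :=
    hD.l_measurable.comp_aemeasurable
      (S.isL2_Y.memLp.1.aemeasurable.prodMk (S.isL2_V.memLp.1.aemeasurable.prodMk
        (hU.memLp.1.aemeasurable.prodMk (measurable_fst.aemeasurable.prodMk
          measurable_snd.aemeasurable))))
  have hl' : AEStronglyMeasurable (fun p : Horizon T × Ω =>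
      D.l (S.Y p.1 p.2) (S.V p.1 p.2) (U p.1 p.2) p.1 p.2)
      (((lebesgue T).restrict (Set.Iic t)).prod P) :=
    hl.aestronglyMeasurable.mono_ac
      (Measure.restrict_le_self.absolutelyContinuous.prod .rfl)
  -- The bound is `C` times the length of `[0, t]`. The swap puts `Ω` first, so that integrating out
  -- time leaves a measurable function of `ω`.
  refine Integrable.of_bound (C := C * ((lebesgue T).restrict (Set.Iic t)).real Set.univ)
    hl'.prod_swap.integral_prod_right' ?_
  filter_upwards [hC] with ω hω
  exact norm_integral_le_of_norm_le_const (ae_of_all _ fun τ => hω _ _ _ _)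

variable {𝒱 : (t : Horizon T) → L2RV d 𝓕 P t → Ω → ℝ}

theorem M_initial (S : Solution D Z U)
    (h𝒱 : ∀ ζ, 𝒱 (Horizon.initial T) ζ =ᵐ[P] fun ω => D.h (ζ.1 ω)) :
    S.M 𝒱 (Horizon.initial T) =ᵐ[P] fun ω => D.h (S.Y (Horizon.initial T) ω) := by
  filter_upwards [h𝒱 (S.stateAt _), S.coeFn_stateAt (Horizon.initial T)] with ω h₁ h₂
  rw [M, h₁, h₂, runningCost_initial, sub_zero]

/-- Since the right side is a sum of integrable terms once `M` is integrable at `T`, this also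
yields the integrability of `𝒱_T(ξ)`. -/
theorem value_final_eq (S : Solution D Z U) :
    𝒱 (Horizon.final T) D.ξ =
      fun ω => S.M 𝒱 (Horizon.final T) ω + S.runningCost (Horizon.final T) ω := by
  funext ω
  rw [M, stateAt_final, sub_add_cancel]

theorem cost_eq (S : Solution D Z U)
    (hR : Integrable (S.runningCost (Horizon.final T)) P)
    (hM : Integrable (S.M 𝒱 (Horizon.initial T)) P)
    (h𝒱 : ∀ ζ, 𝒱 (Horizon.initial T) ζ =ᵐ[P] fun ω => D.h (ζ.1 ω)) :
    S.cost = ∫ ω, S.M 𝒱 (Horizon.initial T) ω ∂P +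
      ∫ ω, S.runningCost (Horizon.final T) ω ∂P := by
  -- `h(Y_0)` inherits integrability from `M` at time `0`, with which it agrees almost surely.
  rw [cost, integral_add (hM.congr (S.M_initial h𝒱)) hR, integral_congr_ae (S.M_initial h𝒱)]

theorem integral_value_final (S : Solution D Z U)
    (hR : Integrable (S.runningCost (Horizon.final T)) P)
    (hM : Integrable (S.M 𝒱 (Horizon.final T)) P) :
    ∫ ω, 𝒱 (Horizon.final T) D.ξ ω ∂P = ∫ ω, S.M 𝒱 (Horizon.final T) ω ∂P +
      ∫ ω, S.runningCost (Horizon.final T) ω ∂P := by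
  rw [value_final_eq (𝒱 := 𝒱) S, integral_add hM hR]

/-- The expected terminal value is a lower bound of the cost of each control along which `M` is a
supermartingale. -/
theorem integral_value_final_le_cost [IsFiniteMeasure P] (hD : D.Standing)
    (hU : IsL2Process 𝓕 P U) (S : Solution D Z U)
    (h𝒱 : ∀ ζ, 𝒱 (Horizon.initial T) ζ =ᵐ[P] fun ω => D.h (ζ.1 ω))
    (hS : Supermartingale (S.M 𝒱) 𝓕 P) :
    ∫ ω, 𝒱 (Horizon.final T) D.ξ ω ∂P ≤ S.cost := by
  have hR := S.integrable_runningCost hD hU (Horizon.final T)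
  rw [S.cost_eq hR (hS.integrable _) h𝒱, S.integral_value_final hR (hS.integrable _)]
  -- Testing the supermartingale inequality on all of `Ω` compares the means at `0` and `T`.
  have hle := hS.setIntegral_le (show Horizon.initial T ≤ Horizon.final T from T.2)
    MeasurableSet.univ
  rw [setIntegral_univ, setIntegral_univ] at hle
  gcongr

/-- The expected terminal value is the cost of each control along which `M` is a martingale. -/
theorem cost_eq_integral_value_final [IsFiniteMeasure P] (hD : D.Standing)
    (hU : IsL2Process 𝓕 P U) (S : Solution D Z U)
    (h𝒱 : ∀ ζ, 𝒱 (Horizon.initial T) ζ =ᵐ[P] fun ω => D.h (ζ.1 ω))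
    (hS : Martingale (S.M 𝒱) 𝓕 P) :
    S.cost = ∫ ω, 𝒱 (Horizon.final T) D.ξ ω ∂P := by
  have hR := S.integrable_runningCost hD hU (Horizon.final T)
  rw [S.cost_eq hR (hS.integrable _) h𝒱, S.integral_value_final hR (hS.integrable _)]
  have heq := hS.setIntegral_eq (show Horizon.initial T ≤ Horizon.final T from T.2)
    MeasurableSet.univ
  rw [setIntegral_univ, setIntegral_univ] at heq
  rw [heq]

end Solution

end BSDEControl

theorem theorem3 {Ω : Type*} {mΩ : MeasurableSpace Ω} (P : Measure Ω) [IsProbabilityMeasure P]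
    (T : ℝ≥0) (d : ℕ)
    -- the Brownian motion that drives the BSDE
    (Z : ℝ≥0 → Ω → ℝ) (hZ : ∀ t, Measurable (Z t)) (hB : IsBrownianReal Z P)
    -- the control problem
    (D : BSDEControl.Data d (BSDEControl.obsFiltration Z hZ T) P) (hD : D.Standing)
    -- the family `𝒱`, with values that may be random
    (𝒱 : (t : BSDEControl.Horizon T) →
      BSDEControl.L2RV d (BSDEControl.obsFiltration Z hZ T) P t → Ω → ℝ)
    (h𝒱 : ∀ ζ : BSDEControl.L2RV d (BSDEControl.obsFiltration Z hZ T) P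
        (BSDEControl.Horizon.initial T),
      𝒱 (BSDEControl.Horizon.initial T) ζ =ᵐ[P] fun ω => D.h (ζ.1 ω))
    -- the control `U*`, with state `(Y*, V*)`
    (Ustar : BSDEControl.Horizon T → Ω → ℝ)
    (hUstar : BSDEControl.IsL2Process (BSDEControl.obsFiltration Z hZ T) P Ustar)
    (Sstar : BSDEControl.Solution D (BSDEControl.restrict Z T) Ustar)
    (hsuper : ∀ U : BSDEControl.Horizon T → Ω → ℝ,
      BSDEControl.IsL2Process (BSDEControl.obsFiltration Z hZ T) P U →
      ∀ S : BSDEControl.Solution D (BSDEControl.restrict Z T) U,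
        Supermartingale (S.M 𝒱) (BSDEControl.obsFiltration Z hZ T) P)
    (hmart : Martingale (Sstar.M 𝒱) (BSDEControl.obsFiltration Z hZ T) P) :
    Sstar.IsOptimal ∧
      Integrable (𝒱 (BSDEControl.Horizon.final T) D.ξ) P ∧
      Sstar.cost = ∫ ω, 𝒱 (BSDEControl.Horizon.final T) D.ξ ω ∂P := by
  have hcost := Sstar.cost_eq_integral_value_final hD hUstar h𝒱 hmart
  refine ⟨⟨hUstar, fun U hU S => ?_⟩, ?_, hcost⟩
  · rw [hcost]
    exact S.integral_value_final_le_cost hD hU h𝒱 (hsuper U hU S)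
  · rw [Sstar.value_final_eq (𝒱 := 𝒱)]
    exact (hmart.integrable _).add (Sstar.integrable_runningCost hD hUstar _)
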